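/- For a set $S$ of positive integers write $S(N) = S \cap \{1,\dots,N\}$ and let $\#S(N)$ be its number of elements. Let $\mathbb{T} = \mathbb{R}/\mathbb{Z}$. Call $S$ \emph{good} if $S$ is infinite and for every $\beta \in \mathbb{T}$ the limit $$\lim_{N\to\infty} \frac{1}{\#S(N)} \sum_{s \in S(N)} e^{2\pi i s\beta}$$ exists. For a good set $S$ and $\alpha \in \mathbb{T}$ the \emph{limit measure} $\mu_{S,\alpha}$ is the Borel probability measure on $\mathbb{T}$ that is the weak limit of the measures $\frac{1}{\#S(N)} \sum_{s \in S(N)} \delta_{s\alpha}$, that is, the unique Borel probability measure with $$\int_{\mathbb{T}} \phi \, d\mu_{S,\alpha} = \lim_{N\to\infty} \frac{1}{\#S(N)} \sum_{s\in S(N)} \phi(s\alpha)$$ for every continuous $\phi : \mathbb{T} \to \mathbb{C}$ (this limit measure always exists when $S$ is good). \textbf{Theorem (absolutely continuous measures can be represented by subsets of a good set).} Let $R$ be a good set which is sublacunary, that is, $$\lim_{N\to\infty} \frac{\log N}{\#R(N)} = 0.$$ Let $\alpha$ be an irrational number, and let $\nu$ be a Borel probability measure on $\mathbb{T}$ that is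 absolutely continuous with respect to $\mu_{R,\alpha}$. Then there is a good set $S \subset R$ which represents $\nu$ at $\alpha$, that is, $\mu_{S,\alpha} = \nu$. -/

import Mathlib

open MeasureTheory Filter Topology

noncomputable section

/-! The natural numbers of the text are the positive integers, so sets of natural numbers are
modelled as `S : Set ℕ` all of whose elements are positive; the torus is `UnitAddCircle`, that is `ℝ / ℤ`, with its Borel
sigma-algebra, and `fourier 1 θ = exp (2 π i θ)`. -/

open Classical in
/-- The initial segment `S(N) = S ∩ {1, …, N}`. -/
def initialSegment (S : Set ℕ) (N : ℕ) : Finset ℕ :=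
  (Finset.Icc 1 N).filter (fun s => s ∈ S)

/-- The arithmetic average of `f` over `S(N)`. -/
def avgAlong (S : Set ℕ) (N : ℕ) (f : ℕ → ℂ) : ℂ :=
  (1 / ((initialSegment S N).card : ℂ)) * ∑ s ∈ initialSegment S N, f s

/-- Good sets: infinite sets of positive integers along which the averages of
`exp (2 π i s β)` converge for every point `β` of the torus. -/
structure IsGoodSet (S : Set ℕ) : Prop where
  pos : ∀ s ∈ S, 0 < s
  infinite : S.Infinite
  converges : ∀ β : UnitAddCircle, ∃ L : ℂ,
    Tendsto (fun N : ℕ => avgAlong S N (fun s => fourier 1 (s • β))) atTop (𝓝 L)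

/-- `log N / #R(N) → 0`. -/
def IsSublacunary (R : Set ℕ) : Prop :=
  Tendsto (fun N : ℕ => Real.log N / ((initialSegment R N).card : ℝ)) atTop (𝓝 0)

/-- `μ` is the weak limit of the averages over `s ∈ S(N)` of the Dirac measures at `s • α`. -/
structure IsLimitMeasure (S : Set ℕ) (α : UnitAddCircle) (μ : Measure UnitAddCircle) :
    Prop where
  prob : IsProbabilityMeasure μ
  tendsto : ∀ φ : C(UnitAddCircle, ℂ),
    Tendsto (fun N : ℕ => avgAlong S N (fun s => φ (s • α))) atTop (𝓝 (∫ x, φ x ∂μ))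

open Classical in
/-- The limit measure `μ_{S,α}`. For a good set the limit exists and is unique, see
`IsGoodSet.isLimitMeasure_limitMeasure` and `IsLimitMeasure.eq_limitMeasure`; where there
is no limit the value is the zero measure. -/
def limitMeasure (S : Set ℕ) (α : UnitAddCircle) : Measure UnitAddCircle :=
  if h : ∃ μ, IsLimitMeasure S α μ then h.choose else 0

theorem IsLimitMeasure.unique {S : Set ℕ} {α : UnitAddCircle} {μ ν : Measure UnitAddCircle}
    (hμ : IsLimitMeasure S α μ) (hν : IsLimitMeasure S α ν) : μ = ν := by
  have := hμ.prob
  have := hν.prob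
  apply ext_of_forall_integral_eq_of_IsFiniteMeasure
  intro f
  have h := tendsto_nhds_unique (hμ.tendsto ⟨fun x => (f x : ℂ), by fun_prop⟩)
    (hν.tendsto ⟨fun x => (f x : ℂ), by fun_prop⟩)
  simp only [ContinuousMap.coe_mk, integral_complex_ofReal] at h
  exact_mod_cast h

theorem IsLimitMeasure.eq_limitMeasure {S : Set ℕ} {α : UnitAddCircle}
    {μ : Measure UnitAddCircle} (hμ : IsLimitMeasure S α μ) : limitMeasure S α = μ := by
  have h : ∃ μ, IsLimitMeasure S α μ := ⟨μ, hμ⟩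
  rw [limitMeasure, dif_pos h]
  exact h.choose_spec.unique hμ

theorem card_initialSegment_pos {S : Set ℕ} (hS : IsGoodSet S) :
    ∀ᶠ N in atTop, 0 < (initialSegment S N).card := by
  obtain ⟨s, hs⟩ := hS.infinite.nonempty
  filter_upwards [eventually_ge_atTop s] with N hN
  exact Finset.card_pos.2 ⟨s, by simp [initialSegment, hs, hN, Nat.one_le_iff_ne_zero,
    (hS.pos s hs).ne']⟩

theorem norm_avgAlong_le (S : Set ℕ) (N : ℕ) (f : ℕ → ℂ) (C : ℝ) (hC : 0 ≤ C)
    (hf : ∀ s, ‖f s‖ ≤ C) : ‖avgAlong S N f‖ ≤ C := by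
  rw [avgAlong, norm_mul, norm_div, norm_one, Complex.norm_natCast]
  have h := norm_sum_le_of_le (initialSegment S N) (fun s _ => hf s)
  rw [Finset.sum_const, nsmul_eq_mul] at h
  rcases Nat.eq_zero_or_pos (initialSegment S N).card with h0 | h0
  · simp [h0, hC]
  · have : (0 : ℝ) < (initialSegment S N).card := by exact_mod_cast h0
    rw [one_div, inv_mul_le_iff₀ this]
    exact h

/-- For a good set the weak limit exists at every point of the torus. -/
theorem IsGoodSet.exists_isLimitMeasure {S : Set ℕ} (hS : IsGoodSet S) (α : UnitAddCircle) :
    ∃ μ, IsLimitMeasure S α μ := by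
  classical
  have hprob : ∀ N, ∃ P : ProbabilityMeasure UnitAddCircle,
      0 < (initialSegment S N).card → ∀ φ : C(UnitAddCircle, ℂ),
        ∫ x, φ x ∂(P : Measure UnitAddCircle) = avgAlong S N (fun s => φ (s • α)) := by
    intro N
    by_cases hN : 0 < (initialSegment S N).card
    · have hN' : ((initialSegment S N).card : ENNReal) ≠ 0 := by exact_mod_cast hN.ne'
      refine ⟨⟨((initialSegment S N).card : ENNReal)⁻¹ •
        ∑ s ∈ initialSegment S N, Measure.dirac (s • α), ⟨?_⟩⟩, fun _ φ => ?_⟩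
      · simp only [Measure.smul_apply, Measure.finsetSum_apply, measure_univ,
          Finset.sum_const, nsmul_eq_mul, mul_one, smul_eq_mul]
        exact ENNReal.inv_mul_cancel hN' (ENNReal.natCast_ne_top _)
      · simp only [ProbabilityMeasure.coe_mk, avgAlong]
        rw [integral_smul_measure, integral_finsetSum_measure]
        · simp [integral_dirac]
        · intro s _
          exact integrable_dirac (by simp)
    · exact ⟨⟨Measure.dirac 0, inferInstance⟩, fun h => absurd h hN⟩
  choose P hP using hprob
  obtain ⟨U, hU⟩ := (atTop : Filter ℕ).exists_ultrafilter_le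
  obtain ⟨μ, -, hμ⟩ := isCompact_univ.ultrafilter_le_nhds (U.map P) (by simp)
  have hμ' : Tendsto P U (𝓝 μ) := hμ
  rw [ProbabilityMeasure.tendsto_iff_forall_integral_rclike_tendsto ℂ] at hμ'
  refine ⟨μ, inferInstance, ?_⟩
  have hint : ∀ φ : C(UnitAddCircle, ℂ), Integrable φ (μ : Measure UnitAddCircle) := fun φ =>
    φ.continuous.integrable_of_hasCompactSupport (HasCompactSupport.of_compactSpace _)
  -- the continuous functions with the asserted convergence form a closed subspace
  let V : Submodule ℂ C(UnitAddCircle, ℂ) :=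
    { carrier := {φ | Tendsto (fun N : ℕ => avgAlong S N (fun s => φ (s • α))) atTop
        (𝓝 (∫ x, φ x ∂(μ : Measure UnitAddCircle)))}
      zero_mem' := by simp [avgAlong]
      add_mem' := by
        intro φ ψ h1 h2
        have h := Tendsto.add h1 h2
        simp only [Set.mem_ofPred_eq, ContinuousMap.add_apply]
        rw [integral_add (hint φ) (hint ψ)]
        refine h.congr fun N => ?_
        simp [avgAlong, Finset.sum_add_distrib, mul_add]
      smul_mem' := by
        intro c φ h1
        have h := Tendsto.const_mul c h1
        simp only [Set.mem_ofPred_eq, ContinuousMap.smul_apply, smul_eq_mul]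
        rw [integral_const_mul]
        refine h.congr fun N => ?_
        simp only [avgAlong, ← Finset.mul_sum]
        ring }
  have hV : IsClosed (V : Set C(UnitAddCircle, ℂ)) := by
    rw [← isSeqClosed_iff_isClosed]
    intro φs φ hmem hlim
    change Tendsto _ _ _
    rw [Metric.tendsto_nhds]
    intro ε hε
    obtain ⟨k, hk⟩ := ((tendsto_iff_norm_sub_tendsto_zero.1 hlim).eventually
      (gt_mem_nhds (show (0 : ℝ) < ε / 3 by positivity))).exists
    have hbd : ∀ x, ‖φs k x - φ x‖ ≤ ε / 3 := fun x =>
      ((φs k - φ).norm_coe_le_norm x).trans hk.le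
    filter_upwards [Metric.tendsto_nhds.1 (hmem k) (ε / 3) (by positivity)] with N hN
    have e1 : ‖avgAlong S N (fun s => φs k (s • α)) - avgAlong S N (fun s => φ (s • α))‖
        ≤ ε / 3 := by
      have := norm_avgAlong_le S N (fun s => φs k (s • α) - φ (s • α)) (ε / 3)
        (by positivity) (fun s => hbd _)
      simpa [avgAlong, Finset.sum_sub_distrib, mul_sub] using this
    have e2 : ‖(∫ x, φs k x ∂(μ : Measure UnitAddCircle)) -
        ∫ x, φ x ∂(μ : Measure UnitAddCircle)‖ ≤ ε / 3 := by
      rw [← integral_sub (hint _) (hint _)]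
      simpa using norm_integral_le_of_norm_le_const (μ := (μ : Measure UnitAddCircle))
        (Eventually.of_forall hbd)
    rw [dist_eq_norm] at hN ⊢
    set a := avgAlong S N (fun s => φs k (s • α))
    set b := avgAlong S N (fun s => φ (s • α))
    set c := ∫ x, φs k x ∂(μ : Measure UnitAddCircle)
    set d := ∫ x, φ x ∂(μ : Measure UnitAddCircle)
    have : b - d = -(a - b) + (a - c) + (c - d) := by ring
    rw [this]
    refine (norm_add₃_le).trans_lt ?_
    rw [norm_neg]
    linarith
  have hF : ∀ n : ℤ, (fourier n : C(UnitAddCircle, ℂ)) ∈ V := by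
    intro n
    obtain ⟨L, hL⟩ := hS.converges (n • α)
    have hL' : Tendsto (fun N : ℕ => avgAlong S N
        (fun s => (fourier n : C(UnitAddCircle, ℂ)) (s • α))) atTop (𝓝 L) := by
      refine hL.congr fun N => ?_
      simp only [avgAlong, fourier_apply, one_smul]
      congr 1
      refine Finset.sum_congr rfl fun s _ => ?_
      rw [smul_comm]
    have h1 := hμ' (BoundedContinuousFunction.mkOfCompact (fourier n))
    have h2 : Tendsto (fun N : ℕ => avgAlong S N
        (fun s => (fourier n : C(UnitAddCircle, ℂ)) (s • α))) U
        (𝓝 (∫ x, (fourier n : C(UnitAddCircle, ℂ)) x ∂(μ : Measure UnitAddCircle))) := by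
      refine h1.congr' ?_
      filter_upwards [hU (card_initialSegment_pos hS)] with N hN
      exact hP N hN (fourier n)
    have := tendsto_nhds_unique (hL'.mono_left hU) h2
    change Tendsto _ _ _
    rwa [this] at hL'
  have hVtop : V = ⊤ := by
    rw [eq_top_iff, ← span_fourier_closure_eq_top (T := (1 : ℝ))]
    refine Submodule.topologicalClosure_minimal _ (Submodule.span_le.2 ?_) hV
    rintro _ ⟨n, rfl⟩
    exact hF n
  intro φ
  have : φ ∈ V := hVtop ▸ Submodule.mem_top
  exact this

theorem IsGoodSet.isLimitMeasure_limitMeasure {S : Set ℕ} (hS : IsGoodSet S)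
    (α : UnitAddCircle) : IsLimitMeasure S α (limitMeasure S α) := by
  obtain ⟨μ, hμ⟩ := hS.exists_isLimitMeasure α
  rw [hμ.eq_limitMeasure]
  exact hμ

end

/-! Let `a` enumerate `R` and let ρ be the density of ν with respect to μ = μ_{R,α}. If ρ were
continuous and bounded by C, one would keep `a i` at random with probability ρ(a_i α)/C. The
averages of ρ(a_i α) e(a_i β) converge for every β: for ρ a character, the product is a character at
mα + β, and trigonometric polynomials are dense (`exists_tendsto_seqAvg_mul_fourier`). The random
errors are o(n) for all β at once, because up to n only polynomially many (in `a n`) values of β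
matter, and log `a n` = o(n) by sublacunarity. The random choice is made deterministic by an
exponential potential (`exists_rounding`, `exists_rounding_fourier`).

For ρ merely integrable, take continuous `g k` → ρ fast in L¹(μ), with bounds `C k`, and keep `a i`
with weight `g (k i) (a i • α) / C (k i)`, where `k i` → ∞ slowly. Slowness makes the diagonal
sequence inherit the limits (`sum_abs_diagonal_sub_le`, `exists_tendsto_of_approx`) and keeps the
rounding error small against the sum of the weights 1/`C (k i)`; as these decrease, they preserve
Cesàro limits (`tendsto_weighted_average`). `exists_selection` assembles this, and Fourier
coefficients identify the limit as ν. -/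

/-! ### Derandomized rounding -/

/-- In exp x ≤ 1 + x + x² the linear terms cancel, since a centred Bernoulli variable has mean zero,
and 1 + p(1 - p)c² remains. -/
theorem bernoulli_exp_le {p c : ℝ} (h0 : 0 ≤ p) (h1 : p ≤ 1) (hc : |c| ≤ 1) :
    p * Real.exp ((1 - p) * c) + (1 - p) * Real.exp ((0 - p) * c) ≤ Real.exp (c ^ 2) := by
  have key : ∀ x : ℝ, |x| ≤ 1 → Real.exp x ≤ 1 + x + x ^ 2 := fun x hx => by
    have := (abs_le.1 (Real.abs_exp_sub_one_sub_id_le hx)).2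
    linarith
  have e1 := key ((1 - p) * c) (by
    rw [abs_mul, abs_of_nonneg (by linarith : 0 ≤ 1 - p)]
    nlinarith [abs_nonneg c])
  have e2 := key ((0 - p) * c) (by
    rw [abs_mul, zero_sub, abs_neg, abs_of_nonneg h0]
    nlinarith [abs_nonneg c])
  have e3 := Real.add_one_le_exp (c ^ 2)
  have e4 := mul_le_mul_of_nonneg_left e1 h0
  have e5 := mul_le_mul_of_nonneg_left e2 (by linarith : 0 ≤ 1 - p)
  have e6 : p * (1 - p) * c ^ 2 ≤ 1 * c ^ 2 :=
    mul_le_mul_of_nonneg_right (by nlinarith) (sq_nonneg c)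
  nlinarith

theorem exists_greedy_sequence {σ τ : Type*} (P : ℕ → σ → Prop) (A : Set τ)
    (step : ℕ → σ → τ → σ) (s₀ : σ) (h₀ : P 0 s₀)
    (H : ∀ n s, P n s → ∃ t ∈ A, P (n + 1) (step n s t)) :
    ∃ (t : ℕ → τ) (s : ℕ → σ), s 0 = s₀ ∧ (∀ n, t n ∈ A) ∧
      (∀ n, s (n + 1) = step n (s n) (t n)) ∧ ∀ n, P n (s n) := by
  choose f hfA hfP using H
  let S : ∀ n, {s // P n s} := fun n =>
    Nat.rec ⟨s₀, h₀⟩ (fun n s => ⟨step n s.1 (f n s.1 s.2), hfP n s.1 s.2⟩) n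
  exact ⟨fun n => f n (S n).1 (S n).2, fun n => (S n).1, rfl, fun n => hfA _ _ _,
    fun n => rfl, fun n => (S n).2⟩

/-- Derandomized Chernoff bound: a sequence in `[0, 1]` can be rounded to a sequence in `{0, 1}`
such that countably many weighted sums of the rounding errors are simultaneously small. -/
theorem exists_rounding {ι : Type*} (q : ι → ℝ) (hq : ∀ ω, 0 < q ω) (hs : Summable q)
    (c : ℕ → ι → ℝ) (lam : ι → ℝ) (hlam : ∀ ω, lam ω ≤ 1) (hc : ∀ i ω, |c i ω| ≤ lam ω)
    (p : ℕ → ℝ) (hp : ∀ i, p i ∈ Set.Icc (0 : ℝ) 1) :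
    ∃ ξ : ℕ → ℝ, (∀ i, ξ i ∈ ({0, 1} : Set ℝ)) ∧ ∀ n ω,
      ∑ i ∈ Finset.range n, (ξ i - p i) * c i ω ≤
        n * lam ω ^ 2 + Real.log ((∑' ω, q ω) / q ω) := by
  -- The potential: under independent rounding with probabilities `p i`, the compensator `n * lam ω
  -- ^ 2` makes its sum over ω a supermartingale.
  let F : ℕ → (ι → ℝ) → ι → ℝ := fun n X ω => q ω * Real.exp (X ω - n * lam ω ^ 2)
  have hsum : ∀ (n : ℕ) (X : ι → ℝ), (∀ ω, X ω ≤ n) → Summable (F n X) := by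
    intro n X hX
    refine Summable.of_nonneg_of_le (fun ω => by have := hq ω; positivity) (fun ω => ?_)
      (hs.mul_right (Real.exp n))
    refine mul_le_mul_of_nonneg_left (Real.exp_le_exp.2 ?_) (hq ω).le
    have := hX ω
    have : 0 ≤ n * lam ω ^ 2 := by positivity
    linarith
  -- The bound `X ω ≤ n` belongs to the invariant because it gives summability; otherwise `∑'` could
  -- be the default value 0.
  obtain ⟨ξ, X, hX0, hξ, hstep, hX⟩ := exists_greedy_sequence
    (fun (n : ℕ) (X : ι → ℝ) => (∀ ω, X ω ≤ n) ∧ ∑' ω, F n X ω ≤ ∑' ω, q ω) ({0, 1} : Set ℝ)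
    (fun n X x ω => X ω + (x - p n) * c n ω) (fun _ => 0) (by simp [F]) (by
      rintro n X ⟨hX, hle⟩
      have hb : ∀ x ∈ ({0, 1} : Set ℝ), ∀ ω, X ω + (x - p n) * c n ω ≤ ((n + 1 : ℕ) : ℝ) := by
        intro x hx ω
        have h1 : |x - p n| ≤ 1 := by
          have := hp n
          rcases hx with rfl | rfl <;> rw [abs_le] <;> constructor <;>
            linarith [this.1, this.2]
        have h2 : (x - p n) * c n ω ≤ 1 := by
          refine (le_abs_self _).trans ?_
          rw [abs_mul]
          exact mul_le_one₀ h1 (abs_nonneg _) ((hc n ω).trans (hlam ω))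
        push_cast
        linarith [hX ω]
      have s0 := hsum (n + 1) _ (hb 0 (by simp))
      have s1 := hsum (n + 1) _ (hb 1 (by simp))
      -- The mean of the potential over the two choices does not exceed its present value, so one of
      -- the choices does not increase it.
      have hmix : p n * ∑' ω, F (n + 1) (fun ω => X ω + (1 - p n) * c n ω) ω +
          (1 - p n) * ∑' ω, F (n + 1) (fun ω => X ω + (0 - p n) * c n ω) ω ≤
          ∑' ω, F n X ω := by
        rw [← tsum_mul_left, ← tsum_mul_left,
          ← (s1.mul_left _).tsum_add (s0.mul_left _)]
        refine ((s1.mul_left _).add (s0.mul_left _)).tsum_le_tsum (fun ω => ?_) (hsum n X hX)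
        have hm := bernoulli_exp_le (hp n).1 (hp n).2 ((hc n ω).trans (hlam ω))
        have hsq : c n ω ^ 2 ≤ lam ω ^ 2 := by
          rw [← sq_abs]
          exact pow_le_pow_left₀ (abs_nonneg _) (hc n ω) 2
        have e : ∀ x : ℝ, F (n + 1) (fun ω => X ω + (x - p n) * c n ω) ω =
            F n X ω * Real.exp (-lam ω ^ 2) * Real.exp ((x - p n) * c n ω) := by
          intro x
          simp only [F]
          rw [mul_assoc, mul_assoc, ← Real.exp_add, ← Real.exp_add]
          congr 2
          push_cast
          ring
        rw [e, e]
        have hF : 0 ≤ F n X ω := by have := hq ω; positivity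
        calc _ = F n X ω * Real.exp (-lam ω ^ 2) * (p n * Real.exp ((1 - p n) * c n ω) +
              (1 - p n) * Real.exp ((0 - p n) * c n ω)) := by ring
          _ ≤ F n X ω * Real.exp (-lam ω ^ 2) * Real.exp (lam ω ^ 2) := by
            gcongr
            exact hm.trans (Real.exp_le_exp.2 hsq)
          _ = F n X ω := by rw [mul_assoc, ← Real.exp_add]; simp
      by_contra! hcon
      have h1 := hcon 1 (by simp) (hb 1 (by simp))
      have h0 := hcon 0 (by simp) (hb 0 (by simp))
      have h2 := hmix.trans hle
      rcases (hp n).1.eq_or_lt with h | h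
      · rw [← h] at h2 h0
        linarith
      · nlinarith [mul_pos h (sub_pos.2 h1),
          mul_nonneg (sub_nonneg.2 (hp n).2) (sub_nonneg.2 h0.le)])
  refine ⟨ξ, hξ, fun n ω => ?_⟩
  have hXeq : ∀ n, X n ω = ∑ i ∈ Finset.range n, (ξ i - p i) * c i ω := by
    intro n
    induction n with
    | zero => simp [hX0]
    | succ n ih => rw [hstep, Finset.sum_range_succ, ← ih]
  rw [← hXeq]
  have h1 : F n (X n) ω ≤ ∑' ω, q ω :=
    ((hsum n (X n) (hX n).1).le_tsum ω (fun j _ => by have := hq j; positivity)).trans (hX n).2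
  have hT : 0 < ∑' ω, q ω := hs.tsum_pos (fun i => (hq i).le) ω (hq ω)
  have h2 : Real.exp (X n ω - n * lam ω ^ 2) ≤ (∑' ω, q ω) / q ω := by
    rw [le_div_iff₀ (hq ω), mul_comm]
    exact h1
  have := (Real.le_log_iff_exp_le (div_pos hT (hq ω))).2 h2
  linarith

/-- The powers of `I` turn one-sided real bounds into bounds on both |re| and |im|. The scale
1/(m+1) trades the quadratic term against the logarithm. `K` is the total weight; it precedes `p`,
so that thresholds derived from it are uniform in `p`. -/
theorem exists_rounding_complex {κ : Type*} (q : κ → ℝ) (hq : ∀ ω, 0 < q ω) (hs : Summable q)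
    (e : ℕ → κ → ℂ) (he : ∀ i ω, ‖e i ω‖ ≤ 1) :
    ∃ K : ℝ, ∀ p : ℕ → ℝ, (∀ i, p i ∈ Set.Icc (0 : ℝ) 1) →
      ∃ ξ : ℕ → ℝ, (∀ i, ξ i ∈ ({0, 1} : Set ℝ)) ∧ ∀ (n m : ℕ) (ω : κ),
        ‖∑ i ∈ Finset.range n, ((ξ i - p i : ℝ) : ℂ) * e i ω‖ ≤
          2 * (n / (m + 1) + (m + 1) * Real.log (K / ((1 / (m + 1) ^ 2) * q ω))) := by
  let r : ℕ → ℝ := fun m => 1 / ((m : ℝ) + 1) ^ 2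
  have hr : Summable r := by
    have := (summable_nat_add_iff 1).2 (Real.summable_one_div_nat_pow.2 (one_lt_two))
    simpa [r] using this
  have hr0 : ∀ m, 0 < r m := fun m => by positivity
  let Q : Fin 4 × ℕ × κ → ℝ := fun ω => 1 * (r ω.2.1 * q ω.2.2)
  have hQ : Summable Q :=
    (Summable.of_finite (f := fun _ : Fin 4 => (1 : ℝ))).mul_of_nonneg
      (hr.mul_of_nonneg hs (fun m => (hr0 m).le) (fun ω => (hq ω).le))
      (fun _ => zero_le_one) (fun ω => mul_nonneg (hr0 _).le (hq _).le)
  refine ⟨∑' ω, Q ω, fun p hp => ?_⟩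
  obtain ⟨ξ, hξ, hb⟩ := exists_rounding Q
    (fun ω => mul_pos one_pos (mul_pos (hr0 _) (hq _))) hQ
    (fun i ω => 1 / ((ω.2.1 : ℝ) + 1) * (Complex.I ^ (ω.1 : ℕ) * e i ω.2.2).re)
    (fun ω => 1 / ((ω.2.1 : ℝ) + 1))
    (fun ω => by rw [div_le_one (by positivity)]; linarith [(Nat.cast_nonneg ω.2.1 : (0:ℝ) ≤ _)])
    (fun i ω => by
      rw [abs_mul, abs_of_nonneg (by positivity)]
      refine mul_le_of_le_one_right (by positivity) ((Complex.abs_re_le_norm _).trans ?_)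
      simpa using he i ω.2.2) p hp
  refine ⟨ξ, hξ, fun n m ω => ?_⟩
  set z := ∑ i ∈ Finset.range n, ((ξ i - p i : ℝ) : ℂ) * e i ω with hz
  set B := n / (m + 1) + (m + 1) * Real.log ((∑' ω, Q ω) / ((1 / (m + 1) ^ 2) * q ω)) with hB
  have key : ∀ s : Fin 4, (Complex.I ^ (s : ℕ) * z).re ≤ B := by
    intro s
    have h := hb n (s, m, ω)
    have hm : (0 : ℝ) < m + 1 := by positivity
    have e1 : ∑ i ∈ Finset.range n, (ξ i - p i) *
        (1 / ((m : ℝ) + 1) * (Complex.I ^ (s : ℕ) * e i ω).re) =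
        1 / ((m : ℝ) + 1) * (Complex.I ^ (s : ℕ) * z).re := by
      rw [hz, Finset.mul_sum, Complex.re_sum, Finset.mul_sum]
      refine Finset.sum_congr rfl fun i _ => ?_
      rw [mul_left_comm (Complex.I ^ (s : ℕ)), Complex.re_ofReal_mul]
      ring
    rw [e1] at h
    simp only [Q, one_mul] at h
    calc (Complex.I ^ (s : ℕ) * z).re
        = (m + 1) * (1 / ((m : ℝ) + 1) * (Complex.I ^ (s : ℕ) * z).re) := by field_simp
      _ ≤ _ := mul_le_mul_of_nonneg_left h hm.le
      _ = B := by
        simp only [hB, Q, r, one_mul]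
        field_simp
  have k0 := key 0
  have k1 := key 1
  have k2 := key 2
  have k3 := key 3
  have I3 : Complex.I ^ 3 = -Complex.I := Complex.I_pow_three
  simp [I3] at k0 k1 k2 k3
  refine (Complex.norm_le_abs_re_add_abs_im z).trans ?_
  have a1 : |z.re| ≤ B := abs_le.2 ⟨by linarith, k0⟩
  have a2 : |z.im| ≤ B := abs_le.2 ⟨by linarith, k3⟩
  linarith

/-! ### Uniformity over all characters -/

theorem norm_fourier_one_nsmul_sub_le (a : ℕ) (x y : ℝ) :
    ‖(fourier 1 (a • (x : UnitAddCircle)) : ℂ) - fourier 1 (a • (y : UnitAddCircle))‖ ≤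
      2 * Real.pi * a * |x - y| := by
  have h : ∀ x : ℝ, (fourier 1 (a • (x : UnitAddCircle)) : ℂ) =
      Complex.exp (Complex.I * ((2 * Real.pi * a * x : ℝ) : ℂ)) := by
    intro x
    rw [← AddCircle.coe_nsmul, fourier_coe_apply]
    congr 1
    push_cast
    simp
    ring
  rw [h, h]
  have e : Complex.exp (Complex.I * ((2 * Real.pi * a * x : ℝ) : ℂ)) =
      Complex.exp (Complex.I * ((2 * Real.pi * a * y : ℝ) : ℂ)) *
      Complex.exp (Complex.I * ((2 * Real.pi * a * (x - y) : ℝ) : ℂ)) := by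
    rw [← Complex.exp_add]
    congr 1
    push_cast
    ring
  rw [e, ← mul_sub_one, norm_mul, mul_comm Complex.I, Complex.norm_exp_ofReal_mul_I, one_mul]
  refine (Real.norm_exp_I_mul_ofReal_sub_one_le).trans ?_
  rw [Real.norm_eq_abs, abs_mul, abs_of_nonneg (by positivity : 0 ≤ 2 * Real.pi * (a : ℝ))]

theorem norm_fourier_one (x : UnitAddCircle) : ‖(fourier 1 x : ℂ)‖ = 1 := by
  rw [fourier_apply]
  exact Circle.norm_coe _

/-- Rounding of weights along a sequence of subexponential growth, uniformly over all characters
of the circle. -/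
theorem exists_rounding_fourier (a : ℕ → ℕ) (ha : StrictMono a)
    (hlog : Tendsto (fun n : ℕ => Real.log (a n) / (n + 1)) atTop (𝓝 0)) :
    ∃ N : ℝ → ℕ, ∀ p : ℕ → ℝ, (∀ i, p i ∈ Set.Icc (0 : ℝ) 1) →
      ∃ ξ : ℕ → ℝ, (∀ i, ξ i ∈ ({0, 1} : Set ℝ)) ∧ ∀ ε > 0, ∀ n ≥ N ε, ∀ β : UnitAddCircle,
        ‖∑ i ∈ Finset.range n, ((ξ i - p i : ℝ) : ℂ) * fourier 1 (a i • β)‖ ≤ ε * n := by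
  let r : ℕ → ℝ := fun m => 1 / ((m : ℝ) + 1) ^ 2
  have hr : Summable r := by
    have := (summable_nat_add_iff 1).2 (Real.summable_one_div_nat_pow.2 (one_lt_two))
    simpa [r] using this
  have hr0 : ∀ m, 0 < r m := fun m => by positivity
  -- The index (M, j) stands for the point j/(M+1). Its weight decays only polynomially, which costs
  -- a logarithm in the bound.
  obtain ⟨K, hK⟩ := exists_rounding_complex (fun ω : ℕ × ℕ => r ω.1 * r ω.2)
    (fun ω => mul_pos (hr0 _) (hr0 _))
    (hr.mul_of_nonneg hr (fun m => (hr0 m).le) (fun m => (hr0 m).le))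
    (fun i ω => fourier 1 (a i • ((((ω.2 : ℝ) / (ω.1 + 1) : ℝ)) : UnitAddCircle)))
    (fun i ω => (norm_fourier_one _).le)
  have hid : ∀ n, n ≤ a n := ha.id_le
  have hlim : ∀ m : ℕ, Tendsto (fun n : ℕ => ((m : ℝ) + 1) *
      (Real.log ((|K| + 1) * (m + 1) ^ 2 * 4 ^ 4) + 8 * Real.log (a n)) / n + 2 * Real.pi / n)
      atTop (𝓝 0) := by
    intro m
    have h1 : Tendsto (fun n : ℕ => (1 : ℝ) / n) atTop (𝓝 0) := tendsto_one_div_atTop_nhds_zero_nat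
    have h2 : Tendsto (fun n : ℕ => Real.log (a n) / n) atTop (𝓝 0) := by
      have h3 : Tendsto (fun n : ℕ => 1 + 1 / (n : ℝ)) atTop (𝓝 (1 + 0)) := h1.const_add 1
      have := hlog.mul h3
      rw [zero_mul] at this
      refine this.congr' ?_
      filter_upwards [eventually_gt_atTop 0] with n hn
      have : (0 : ℝ) < n := by exact_mod_cast hn
      field_simp
    have h4 := ((h1.const_mul (((m : ℝ) + 1) * Real.log ((|K| + 1) * (m + 1) ^ 2 * 4 ^ 4))).add
      (h2.const_mul (((m : ℝ) + 1) * 8))).add (h1.const_mul (2 * Real.pi))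
    simp only [mul_zero, add_zero] at h4
    refine h4.congr fun n => ?_
    ring
  -- The threshold comes before `p`: the weights rounded in `exists_selection` are themselves built
  -- from it.
  have hN : ∀ ε : ℝ, ∃ N : ℕ, 0 < ε → ∀ p : ℕ → ℝ, (∀ i, p i ∈ Set.Icc (0 : ℝ) 1) →
      ∀ ξ : ℕ → ℝ, (∀ i, ξ i ∈ ({0, 1} : Set ℝ)) → 
      (∀ (n m : ℕ) (ω : ℕ × ℕ),
        ‖∑ i ∈ Finset.range n, ((ξ i - p i : ℝ) : ℂ) *
          fourier 1 (a i • ((((ω.2 : ℝ) / (ω.1 + 1) : ℝ)) : UnitAddCircle))‖ ≤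
          2 * (n / (m + 1) + (m + 1) * Real.log (K / ((1 / (m + 1) ^ 2) * (r ω.1 * r ω.2))))) →
      ∀ n ≥ N, ∀ β : UnitAddCircle,
        ‖∑ i ∈ Finset.range n, ((ξ i - p i : ℝ) : ℂ) * fourier 1 (a i • β)‖ ≤ ε * n := by
    intro ε
    by_cases hε : 0 < ε
    swap
    · exact ⟨0, fun h => absurd h hε⟩
    obtain ⟨m, hm⟩ := exists_nat_one_div_lt (show 0 < ε / 4 by positivity)
    obtain ⟨N, hN⟩ := eventually_atTop.1
      ((hlim m).eventually (gt_mem_nhds (show 0 < ε / 4 by positivity)))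
    refine ⟨N + 1, fun _ p hp ξ hξ hb n hn β => ?_⟩
    have hn0 : (0 : ℝ) < n := by exact_mod_cast (by omega : 0 < n)
    have hA : (1 : ℝ) ≤ a n := by exact_mod_cast (by have := hid n; omega : 1 ≤ a n)
    have hAn : (n : ℝ) ≤ a n := by exact_mod_cast hid n
    -- the grid point
    obtain ⟨x, hx, rfl⟩ : ∃ x ∈ Set.Ico (0 : ℝ) 1, (x : UnitAddCircle) = β := by
      obtain ⟨x, hx⟩ := (AddCircle.coe_image_Ico_eq (1 : ℝ) 0).symm ▸ Set.mem_univ β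
      exact ⟨x, by simpa using hx.1, hx.2⟩
    -- With mesh 1/(a n)², moving to the grid costs at most n · 2π (a n)/(a n)² ≤ 2π in total, as n
    -- ≤ a n. Then (M+1)²(j+1)² ≤ 4 (a n)⁸, whence the factor 8 before the logarithm.
    obtain ⟨M, hM⟩ : ∃ M : ℕ, M + 1 = (a n) ^ 2 :=
      ⟨(a n) ^ 2 - 1, Nat.sub_add_cancel (Nat.one_le_pow _ _ (by exact_mod_cast hA))⟩
    have hM' : (M : ℝ) + 1 = (a n : ℝ) ^ 2 := by exact_mod_cast hM
    set j := ⌊x * (M + 1)⌋₊ with hj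
    have hMpos : (0 : ℝ) < M + 1 := by positivity
    have hj1 : (j : ℝ) ≤ x * (M + 1) := Nat.floor_le (mul_nonneg hx.1 hMpos.le)
    have hj2 : x * (M + 1) < j + 1 := Nat.lt_floor_add_one _
    have hjM : (j : ℝ) ≤ M + 1 := hj1.trans (mul_le_of_le_one_left hMpos.le hx.2.le)
    have hxj : |x - (j : ℝ) / (M + 1)| ≤ 1 / (M + 1) := by
      have e : x - (j : ℝ) / (M + 1) = (x * (M + 1) - j) / (M + 1) := by field_simp
      rw [e, abs_of_nonneg (div_nonneg (by linarith) hMpos.le)]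
      gcongr
      linarith
    have hgrid := hb n m (M, j)
    have hdiff : ‖(∑ i ∈ Finset.range n, ((ξ i - p i : ℝ) : ℂ) *
          fourier 1 (a i • (x : UnitAddCircle))) -
        ∑ i ∈ Finset.range n, ((ξ i - p i : ℝ) : ℂ) *
          fourier 1 (a i • ((((j : ℝ) / (M + 1) : ℝ)) : UnitAddCircle))‖ ≤ 2 * Real.pi := by
      rw [← Finset.sum_sub_distrib]
      refine (norm_sum_le_of_le (f := _) (n := fun _ => 2 * Real.pi * (a n) * (1 / (M + 1))) _
        fun i hi => ?_).trans ?_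
      · rw [← mul_sub, norm_mul]
        have h1 : ‖((ξ i - p i : ℝ) : ℂ)‖ ≤ 1 := by
          rw [Complex.norm_real, Real.norm_eq_abs]
          have := hp i
          rcases hξ i with h | h <;> rw [h, abs_le] <;> constructor <;>
            linarith [this.1, this.2]
        have h2 := norm_fourier_one_nsmul_sub_le (a i) x ((j : ℝ) / (M + 1))
        have h3 : (a i : ℝ) ≤ a n := by
          exact_mod_cast ha.monotone (Finset.mem_range.1 hi).le
        refine (mul_le_of_le_one_left (norm_nonneg _) h1).trans (h2.trans ?_)
        gcongr
      · rw [Finset.sum_const, Finset.card_range, nsmul_eq_mul, hM']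
        have : (n : ℝ) * (2 * Real.pi * a n * (1 / (a n : ℝ) ^ 2)) = 2 * Real.pi * (n / a n) := by
          field_simp
        rw [this]
        exact mul_le_of_le_one_right (by positivity) ((div_le_one (by positivity)).2 hAn)
    have hlogle : Real.log (K / ((1 / (m + 1) ^ 2) * (r M * r j))) ≤
        Real.log ((|K| + 1) * (m + 1) ^ 2 * 4 ^ 4) + 8 * Real.log (a n) := by
      have e : K / ((1 / ((m : ℝ) + 1) ^ 2) * (r M * r j)) =
          K * (m + 1) ^ 2 * ((M + 1) ^ 2 * (j + 1) ^ 2) := by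
        simp only [r]
        field_simp
      have e2 : Real.log ((|K| + 1) * (m + 1) ^ 2 * 4 ^ 4) + 8 * Real.log (a n) =
          Real.log ((|K| + 1) * (m + 1) ^ 2 * 4 ^ 4 * (a n : ℝ) ^ 8) := by
        rw [Real.log_mul (y := (a n : ℝ) ^ 8) (by positivity) (by positivity), Real.log_pow,
          Nat.cast_ofNat]
      -- Nothing is known about the sign of `K`; for `K = 0` the logarithm takes its default value
      -- 0.
      rw [e, e2, ← Real.log_abs]
      rcases eq_or_ne K 0 with h0 | h0
      · rw [h0]
        simp only [zero_mul, abs_zero, Real.log_zero]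
        refine Real.log_nonneg ?_
        have : (1 : ℝ) ≤ (m + 1) ^ 2 := one_le_pow₀ (by linarith [(Nat.cast_nonneg m : (0:ℝ) ≤ m)])
        have : (1 : ℝ) ≤ (a n : ℝ) ^ 8 := one_le_pow₀ hA
        refine one_le_mul_of_one_le_of_one_le ?_ this
        nlinarith
      refine Real.log_le_log (by positivity) ?_
      rw [abs_mul, abs_mul, abs_of_nonneg (by positivity : (0 : ℝ) ≤ ((m : ℝ) + 1) ^ 2),
        abs_of_nonneg (by positivity : (0 : ℝ) ≤ ((M : ℝ) + 1) ^ 2 * ((j : ℝ) + 1) ^ 2)]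
      rw [mul_assoc ((|K| + 1) * ((m : ℝ) + 1) ^ 2)]
      have hj3 : (j : ℝ) + 1 ≤ 2 * (a n : ℝ) ^ 2 := by
        have : (1 : ℝ) ≤ (a n : ℝ) ^ 2 := one_le_pow₀ hA
        linarith
      have : ((M : ℝ) + 1) ^ 2 * ((j : ℝ) + 1) ^ 2 ≤ 4 ^ 4 * (a n : ℝ) ^ 8 := by
        rw [hM']
        calc ((a n : ℝ) ^ 2) ^ 2 * ((j : ℝ) + 1) ^ 2
            ≤ ((a n : ℝ) ^ 2) ^ 2 * (2 * (a n : ℝ) ^ 2) ^ 2 := by gcongr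
          _ = 4 * (a n : ℝ) ^ 8 := by ring
          _ ≤ _ := by gcongr; norm_num
      gcongr
      linarith
    have hNn := hN n (by omega)
    have hm0 : (0 : ℝ) < m + 1 := by positivity
    set B := Real.log ((|K| + 1) * (m + 1) ^ 2 * 4 ^ 4) + 8 * Real.log (a n)
    have hNn' : ((m : ℝ) + 1) * B + 2 * Real.pi < ε / 4 * n := by
      rw [← add_div, div_lt_iff₀ hn0] at hNn
      exact hNn
    have h5 : (n : ℝ) / (m + 1) ≤ ε / 4 * n := by
      have := mul_le_mul_of_nonneg_left hm.le hn0.le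
      calc (n : ℝ) / (m + 1) = n * (1 / (m + 1)) := by ring
        _ ≤ _ := this
        _ = _ := by ring
    have h6 := mul_le_mul_of_nonneg_left hlogle hm0.le
    have h7 := norm_le_norm_add_norm_sub' (∑ i ∈ Finset.range n, ((ξ i - p i : ℝ) : ℂ) *
          fourier 1 (a i • (x : UnitAddCircle))) (∑ i ∈ Finset.range n, ((ξ i - p i : ℝ) : ℂ) *
          fourier 1 (a i • ((((j : ℝ) / (M + 1) : ℝ)) : UnitAddCircle)))
    simp only at hgrid
    have := Real.pi_pos
    linarith
  choose N hN using hN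
  refine ⟨N, fun p hp => ?_⟩
  obtain ⟨ξ, hξ, hb⟩ := hK p hp
  exact ⟨ξ, hξ, fun ε hε n hn β => hN ε hε p hp ξ hξ hb n hn β⟩

/-! ### Summation by parts and weighted averages -/

theorem sum_mul_eq_by_parts (w : ℕ → ℝ) (y : ℕ → ℂ) (n : ℕ) :
    ∑ i ∈ Finset.range n, (w i : ℂ) * y i =
      w n * ∑ i ∈ Finset.range n, y i +
        ∑ i ∈ Finset.range n, ((w i - w (i + 1) : ℝ) : ℂ) * ∑ l ∈ Finset.range (i + 1), y l := by
  induction n with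
  | zero => simp
  | succ n ih =>
    rw [Finset.sum_range_succ, ih,
      Finset.sum_range_succ (fun i => ((w i - w (i + 1) : ℝ) : ℂ) * ∑ l ∈ Finset.range (i + 1), y l),
      Finset.sum_range_succ y n]
    push_cast
    ring

/-- For decreasing weights all coefficients in the summation by parts are nonnegative, so the bound
on partial sums can be inserted termwise; summing back by parts gives the right-hand side. -/
theorem norm_weighted_sum_le {w : ℕ → ℝ} (hw : Antitone w) (hpos : ∀ i, 0 < w i) {y : ℕ → ℂ}
    {ε C : ℝ} (h : ∀ n : ℕ, ‖∑ i ∈ Finset.range n, y i‖ ≤ ε * n + C) (n : ℕ) :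
    ‖∑ i ∈ Finset.range n, (w i : ℂ) * y i‖ ≤ ε * ∑ i ∈ Finset.range n, w i + C * w 0 := by
  have e : ∀ n : ℕ, w n * (ε * n + C) +
      ∑ i ∈ Finset.range n, (w i - w (i + 1)) * (ε * (i + 1 : ℕ) + C) =
      ε * ∑ i ∈ Finset.range n, w i + C * w 0 := by
    intro n
    induction n with
    | zero => simp [mul_comm]
    | succ n ih =>
      rw [Finset.sum_range_succ, Finset.sum_range_succ w, mul_add ε]
      push_cast at ih ⊢
      linear_combination ih
  rw [sum_mul_eq_by_parts, ← e]
  refine (norm_add_le _ _).trans (add_le_add ?_ (norm_sum_le_of_le _ fun i _ => ?_))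
  · rw [norm_mul, Complex.norm_real, Real.norm_eq_abs, abs_of_pos (hpos n)]
    exact mul_le_mul_of_nonneg_left (h n) (hpos n).le
  · have := sub_nonneg.2 (hw (Nat.le_succ i))
    rw [norm_mul, Complex.norm_real, Real.norm_eq_abs, abs_of_nonneg this]
    exact mul_le_mul_of_nonneg_left (h (i + 1)) this

/-- The Cesàro average of the first `n` terms. -/
noncomputable def seqAvg (f : ℕ → ℂ) (n : ℕ) : ℂ :=
  (1 / (n : ℂ)) * ∑ i ∈ Finset.range n, f i

theorem seqAvg_add (f g : ℕ → ℂ) (n : ℕ) :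
    seqAvg (fun i => f i + g i) n = seqAvg f n + seqAvg g n := by
  simp [seqAvg, Finset.sum_add_distrib, mul_add]

theorem seqAvg_sub (f g : ℕ → ℂ) (n : ℕ) :
    seqAvg (fun i => f i - g i) n = seqAvg f n - seqAvg g n := by
  simp [seqAvg, Finset.sum_sub_distrib, mul_sub]

theorem seqAvg_const_mul (c : ℂ) (f : ℕ → ℂ) (n : ℕ) :
    seqAvg (fun i => c * f i) n = c * seqAvg f n := by
  simp only [seqAvg, ← Finset.mul_sum]
  ring

theorem norm_seqAvg_le (f : ℕ → ℂ) (n : ℕ) :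
    ‖seqAvg f n‖ ≤ (∑ i ∈ Finset.range n, ‖f i‖) / n := by
  rw [seqAvg, norm_mul, norm_div, norm_one, Complex.norm_natCast, one_div, div_eq_inv_mul]
  gcongr
  exact norm_sum_le _ _

/-- Decreasing weights of infinite total mass preserve Cesàro convergence. -/
theorem tendsto_weighted_average {w : ℕ → ℝ} (hw : Antitone w) (hpos : ∀ i, 0 < w i)
    (hW : Tendsto (fun n => ∑ i ∈ Finset.range n, w i) atTop atTop) {y : ℕ → ℂ} {L : ℂ}
    (hy : Tendsto (seqAvg y) atTop (𝓝 L)) :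
    Tendsto (fun n => (∑ i ∈ Finset.range n, (w i : ℂ) * y i) /
      ((∑ i ∈ Finset.range n, w i : ℝ) : ℂ)) atTop (𝓝 L) := by
  rw [Metric.tendsto_nhds]
  intro ε hε
  obtain ⟨C, hC⟩ : ∃ C : ℝ, ∀ n : ℕ, ‖∑ i ∈ Finset.range n, (y i - L)‖ ≤ ε / 2 * n + C := by
    obtain ⟨N, hN⟩ := eventually_atTop.1 (Metric.tendsto_nhds.1 hy (ε / 2) (by positivity))
    refine ⟨∑ n ∈ Finset.range (N + 1), ‖∑ i ∈ Finset.range n, (y i - L)‖, fun n => ?_⟩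
    by_cases hn : n < N + 1
    · have := Finset.single_le_sum (f := fun n => ‖∑ i ∈ Finset.range n, (y i - L)‖)
        (fun i _ => norm_nonneg _) (Finset.mem_range.2 hn)
      have h2 : 0 ≤ ε / 2 * n := by positivity
      linarith
    · have h1 := hN n (by omega)
      have hn0 : (0 : ℝ) < n := by exact_mod_cast (by omega : 0 < n)
      have hn1 : (n : ℂ) ≠ 0 := by exact_mod_cast hn0.ne'
      have h2 : ∑ i ∈ Finset.range n, (y i - L) = n * (seqAvg y n - L) := by
        rw [Finset.sum_sub_distrib, seqAvg]
        simp
        field_simp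
      have h3 : 0 ≤ ∑ n ∈ Finset.range (N + 1), ‖∑ i ∈ Finset.range n, (y i - L)‖ :=
        Finset.sum_nonneg fun _ _ => norm_nonneg _
      rw [h2, norm_mul, Complex.norm_natCast]
      rw [dist_eq_norm] at h1
      nlinarith
  filter_upwards [hW.eventually_gt_atTop (max 0 (2 * |C| * w 0 / ε))] with n hn
  set W := ∑ i ∈ Finset.range n, w i with hWdef
  have hW0 : 0 < W := (le_max_left _ _).trans_lt hn
  have hW1 : (W : ℂ) ≠ 0 := by exact_mod_cast hW0.ne'
  have h1 := norm_weighted_sum_le hw hpos hC n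
  have h2 : (∑ i ∈ Finset.range n, (w i : ℂ) * y i) / (W : ℂ) - L =
      (∑ i ∈ Finset.range n, (w i : ℂ) * (y i - L)) / W := by
    rw [div_sub' hW1]
    congr 1
    simp only [mul_sub, Finset.sum_sub_distrib, ← Finset.sum_mul]
    rw [hWdef]
    push_cast
    ring
  rw [dist_eq_norm, h2, norm_div, Complex.norm_real, Real.norm_eq_abs, abs_of_pos hW0,
    div_lt_iff₀ hW0]
  have h3 := (le_max_right _ _).trans_lt hn
  rw [div_lt_iff₀ hε] at h3
  have := mul_le_mul_of_nonneg_right (le_abs_self C) (hpos 0).le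
  linarith

/-! ### Diagonal sequences and exchange of limits -/

/-- A function increasing to infinity as slowly as prescribed. -/
theorem exists_slow_monotone (T : ℕ → ℕ) :
    ∃ k : ℕ → ℕ, Monotone k ∧ Tendsto k atTop atTop ∧ ∀ n l, 0 < l → l ≤ k n → T l ≤ n := by
  -- `U` dominates all earlier `T` and satisfies `l ≤ U l`, so a search bounded by `n` misses
  -- nothing. The search also returns 0 when it fails, hence the restriction `0 < l`.
  let U : ℕ → ℕ := fun l => ∑ j ∈ Finset.range (l + 1), (T j + 1)
  have hU : ∀ l, l ≤ U l := by
    intro l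
    have : ∑ j ∈ Finset.range (l + 1), 1 ≤ U l := Finset.sum_le_sum fun j _ => by omega
    simp at this
    omega
  have hUm : ∀ l m, l ≤ m → T l ≤ U m := fun l m h => by
    have := Finset.single_le_sum (f := fun j => T j + 1) (fun _ _ => Nat.zero_le _)
      (Finset.mem_range.2 (Nat.lt_succ_of_le h))
    change _ ≤ U m at this
    omega
  refine ⟨fun n => Nat.findGreatest (fun l => U l ≤ n) n, fun m n h => ?_, ?_, ?_⟩
  · exact Nat.findGreatest_mono (fun l hl => hl.trans h) h
  · refine tendsto_atTop.2 fun b => ?_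
    filter_upwards [eventually_ge_atTop (U b)] with n hn
    exact Nat.le_findGreatest ((hU b).trans hn) hn
  · intro n l hl hle
    exact (hUm l _ hle).trans
      (Nat.findGreatest_of_ne_zero (P := fun l => U l ≤ n) rfl (hl.trans_le hle).ne')

/-- Telescope from level `j` to level `k i ≤ k n` and exchange the sums: level `l` costs `n *
(1/2)^l`, a geometric tail. The finitely many `i` with `k i < j` go into the constant. -/
theorem sum_abs_diagonal_sub_le (x : ℕ → ℕ → ℝ) {k : ℕ → ℕ} (hk : Monotone k)
    (hk' : Tendsto k atTop atTop)
    (h : ∀ n l, l < k n →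
      ∑ i ∈ Finset.range n, |x (l + 1) i - x l i| ≤ n * (1 / 2 : ℝ) ^ l) (j : ℕ) :
    ∃ C : ℝ, ∀ n : ℕ,
      ∑ i ∈ Finset.range n, |x (k i) i - x j i| ≤ C + n * (2 * (1 / 2 : ℝ) ^ j) := by
  obtain ⟨I, hI⟩ := eventually_atTop.1 (hk'.eventually_ge_atTop j)
  refine ⟨∑ i ∈ Finset.range I, |x (k i) i - x j i|, fun n => ?_⟩
  have h1 : ∀ i ∈ Finset.range n, |x (k i) i - x j i| ≤
      (if i < I then |x (k i) i - x j i| else 0) +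
        ∑ l ∈ Finset.Ico j (k n), |x (l + 1) i - x l i| := by
    intro i hi
    have h0 : 0 ≤ ∑ l ∈ Finset.Ico j (k n), |x (l + 1) i - x l i| :=
      Finset.sum_nonneg fun _ _ => abs_nonneg _
    split_ifs with hiI
    · linarith
    · have hj := hI i (by omega)
      rw [zero_add, ← Finset.sum_Ico_sub (fun l => x l i) hj]
      refine (Finset.abs_sum_le_sum_abs _ _).trans
        (Finset.sum_le_sum_of_subset_of_nonneg ?_ fun _ _ _ => abs_nonneg _)
      exact Finset.Ico_subset_Ico_right (hk (Finset.mem_range.1 hi).le)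
  refine (Finset.sum_le_sum h1).trans ?_
  rw [Finset.sum_add_distrib, Finset.sum_comm]
  refine add_le_add ?_ ?_
  · rw [← Finset.sum_filter]
    refine Finset.sum_le_sum_of_subset_of_nonneg (fun i hi => ?_) fun _ _ _ => abs_nonneg _
    simp at hi ⊢
    exact hi.2
  · refine (Finset.sum_le_sum fun l hl => h n l (Finset.mem_Ico.1 hl).2).trans ?_
    rw [← Finset.mul_sum]
    refine mul_le_mul_of_nonneg_left ?_ (Nat.cast_nonneg n)
    have h2 : ∀ m, j ≤ m → ∑ l ∈ Finset.Ico j m, (1 / 2 : ℝ) ^ l =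
        2 * (1 / 2 : ℝ) ^ j - 2 * (1 / 2 : ℝ) ^ m := by
      intro m hm
      induction m, hm using Nat.le_induction with
      | base => simp
      | succ m hm ih => rw [Finset.sum_Ico_succ_top hm, ih]; ring
    by_cases hm : j ≤ k n
    · rw [h2 _ hm]
      have : (0 : ℝ) ≤ 2 * (1 / 2 : ℝ) ^ (k n) := by positivity
      linarith
    · rw [Finset.Ico_eq_empty_of_le (by omega), Finset.sum_empty]
      positivity

/-- Convergent sequences approximating `u` arbitrarily well force `u` to be Cauchy. -/
theorem exists_tendsto_of_approx {u : ℕ → ℂ} {v : ℕ → ℕ → ℂ} {L : ℕ → ℂ} {ε : ℕ → ℝ}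
    (hv : ∀ j, Tendsto (v j) atTop (𝓝 (L j))) (hε : Tendsto ε atTop (𝓝 0))
    (h : ∀ j, ∀ᶠ n in atTop, ‖u n - v j n‖ ≤ ε j) :
    ∃ l, Tendsto u atTop (𝓝 l) ∧ Tendsto L atTop (𝓝 l) := by
  have hu : CauchySeq u := by
    rw [Metric.cauchySeq_iff']
    intro δ hδ
    obtain ⟨j, hj⟩ := (hε.eventually (gt_mem_nhds (show 0 < δ / 4 by positivity))).exists
    obtain ⟨N, hN⟩ := eventually_atTop.1
      ((h j).and (Metric.tendsto_nhds.1 (hv j) (δ / 4) (by positivity)))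
    refine ⟨N, fun n hn => ?_⟩
    have a1 := hN n hn
    have a2 := hN N le_rfl
    rw [← dist_eq_norm] at a1 a2
    have := dist_triangle4 (u n) (v j n) (v j N) (u N)
    have := dist_triangle_right (v j n) (v j N) (L j)
    rw [dist_comm (v j N) (u N)] at *
    linarith [a1.1, a1.2, a2.1, a2.2]
  obtain ⟨l, hl⟩ := cauchySeq_tendsto_of_complete hu
  refine ⟨l, hl, ?_⟩
  rw [tendsto_iff_norm_sub_tendsto_zero]
  refine squeeze_zero (fun _ => norm_nonneg _) (fun j => ?_) hε
  rw [norm_sub_rev]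
  exact le_of_tendsto (hl.sub (hv j)).norm (h j)

/-! ### Fourier analysis on the circle -/

/-- If the averages of all characters along a sequence converge, so do the averages of a continuous
function of one rotation times a character of another. -/
theorem exists_tendsto_seqAvg_mul_fourier {a : ℕ → ℕ}
    (hgood : ∀ β : UnitAddCircle, ∃ L : ℂ,
      Tendsto (seqAvg fun i => fourier 1 (a i • β)) atTop (𝓝 L))
    (α β : UnitAddCircle) (φ : C(UnitAddCircle, ℂ)) :
    ∃ L : ℂ, Tendsto (seqAvg fun i => φ (a i • α) * fourier 1 (a i • β)) atTop (𝓝 L) := by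
  have hspan : ∀ φ ∈ Submodule.span ℂ (Set.range (fourier (T := (1 : ℝ)))),
      ∃ L : ℂ, Tendsto (seqAvg fun i => φ (a i • α) * fourier 1 (a i • β)) atTop (𝓝 L) := by
    intro φ hφ
    induction hφ using Submodule.span_induction with
    | mem φ h =>
      obtain ⟨m, rfl⟩ := h
      -- The m-th character at aα times the first at aβ is the first character at a(mα + β).
      obtain ⟨L, hL⟩ := hgood (m • α + β)
      refine ⟨L, hL.congr fun n => ?_⟩
      congr 1
      funext i
      simp only [fourier_apply, one_smul, smul_add, AddCircle.toCircle_add, Circle.coe_mul]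
      rw [smul_comm]
    | zero => exact ⟨0, by simp [show seqAvg (fun _ => 0) = fun _ => 0 from funext fun n => by simp [seqAvg]]⟩
    | add φ ψ _ _ h1 h2 =>
      obtain ⟨L1, h1⟩ := h1
      obtain ⟨L2, h2⟩ := h2
      refine ⟨L1 + L2, (h1.add h2).congr fun n => ?_⟩
      rw [← seqAvg_add]
      congr 1
      funext i
      simp [add_mul]
    | smul c φ _ h1 =>
      obtain ⟨L1, h1⟩ := h1
      refine ⟨c * L1, (h1.const_mul c).congr fun n => ?_⟩
      rw [← seqAvg_const_mul]
      congr 1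
      funext i
      simp [mul_assoc]
  have hmem : φ ∈ closure (Submodule.span ℂ (Set.range (fourier (T := (1 : ℝ)))) :
      Set C(UnitAddCircle, ℂ)) := by
    rw [← Submodule.topologicalClosure_coe, span_fourier_closure_eq_top]
    trivial
  obtain ⟨ψ, hψ, hlim⟩ := mem_closure_iff_seq_limit.1 hmem
  choose L hL using fun j => hspan (ψ j) (hψ j)
  obtain ⟨l, hl, -⟩ := exists_tendsto_of_approx
    (u := seqAvg fun i => φ (a i • α) * fourier 1 (a i • β)) hL
    (tendsto_iff_norm_sub_tendsto_zero.1 hlim) (fun j => by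
      filter_upwards [eventually_gt_atTop 0] with n hn
      rw [← seqAvg_sub]
      refine (norm_seqAvg_le _ _).trans ?_
      rw [div_le_iff₀ (by exact_mod_cast hn), mul_comm, ← nsmul_eq_mul]
      refine (Finset.sum_le_card_nsmul _ _ ‖ψ j - φ‖ fun i _ => ?_).trans_eq (by simp)
      rw [← sub_mul, norm_mul, norm_fourier_one, mul_one, norm_sub_rev]
      exact (ψ j - φ).norm_coe_le_norm _)
  exact ⟨l, hl⟩

theorem ContinuousMap.integrable_circle {E : Type*} [NormedAddCommGroup E]
    (μ : Measure UnitAddCircle) [IsFiniteMeasure μ] (φ : C(UnitAddCircle, E)) :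
    Integrable φ μ :=
  φ.continuous.integrable_of_hasCompactSupport (HasCompactSupport.of_compactSpace _)

theorem measure_eq_of_integral_fourier_eq {μ ν : Measure UnitAddCircle} [IsFiniteMeasure μ]
    [IsFiniteMeasure ν] (h : ∀ m : ℤ, ∫ x, (fourier m x : ℂ) ∂μ = ∫ x, (fourier m x : ℂ) ∂ν) :
    μ = ν := by
  have hint : ∀ (κ : Measure UnitAddCircle) [IsFiniteMeasure κ] (φ : C(UnitAddCircle, ℂ)),
    Integrable φ κ := fun κ _ φ => φ.integrable_circle κ
  have hspan : ∀ φ ∈ Submodule.span ℂ (Set.range (fourier (T := (1 : ℝ)))),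
      ∫ x, φ x ∂μ = ∫ x, φ x ∂ν := by
    intro φ hφ
    induction hφ using Submodule.span_induction with
    | mem φ hm =>
      obtain ⟨m, rfl⟩ := hm
      exact h m
    | zero => simp
    | add φ ψ _ _ h1 h2 =>
      simp only [ContinuousMap.add_apply]
      rw [integral_add (hint _ _) (hint _ _), integral_add (hint _ _) (hint _ _), h1, h2]
    | smul c φ _ h1 =>
      simp only [ContinuousMap.smul_apply]
      rw [integral_smul, integral_smul, h1]
  have hcont : ∀ (κ : Measure UnitAddCircle) [IsFiniteMeasure κ],
      Continuous fun φ : C(UnitAddCircle, ℂ) => ∫ x, φ x ∂κ := by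
    intro κ _
    refine LipschitzWith.continuous (K := (κ Set.univ).toNNReal) (LipschitzWith.of_dist_le_mul ?_)
    intro φ ψ
    rw [dist_eq_norm, ← integral_sub (hint _ _) (hint _ _), mul_comm, dist_eq_norm]
    exact norm_integral_le_of_norm_le_const (Eventually.of_forall fun x =>
      (φ - ψ).norm_coe_le_norm x)
  have hall : ∀ φ : C(UnitAddCircle, ℂ), ∫ x, φ x ∂μ = ∫ x, φ x ∂ν := by
    intro φ
    have hmem : φ ∈ closure (Submodule.span ℂ (Set.range (fourier (T := (1 : ℝ)))) :
        Set C(UnitAddCircle, ℂ)) := by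
      rw [← Submodule.topologicalClosure_coe, span_fourier_closure_eq_top]
      trivial
    exact closure_minimal (fun φ hφ => hspan φ hφ) (isClosed_eq (hcont μ) (hcont ν)) hmem
  apply ext_of_forall_integral_eq_of_IsFiniteMeasure
  intro f
  have h := hall ⟨fun x => (f x : ℂ), by fun_prop⟩
  simp only [ContinuousMap.coe_mk, integral_complex_ofReal] at h
  exact_mod_cast h

/-- Taking the positive part brings an approximant no farther from ρ ≥ 0. Nonnegativity is needed
because the values become selection probabilities. -/
theorem exists_continuous_nonneg_approx {μ : Measure UnitAddCircle} [IsFiniteMeasure μ]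
    {ρ : UnitAddCircle → ℝ} (hρ : Integrable ρ μ) (h0 : ∀ x, 0 ≤ ρ x) {ε : ℝ} (hε : 0 < ε) :
    ∃ g : C(UnitAddCircle, ℝ), (∀ x, 0 ≤ g x) ∧ ∫ x, |ρ x - g x| ∂μ ≤ ε := by
  obtain ⟨g, hg, hgi⟩ := hρ.exists_boundedContinuous_integral_sub_le hε
  refine ⟨⟨fun x => max (g x) 0, by fun_prop⟩, fun x => le_max_right _ _, le_trans ?_ hg⟩
  refine integral_mono_of_nonneg (Eventually.of_forall fun x => abs_nonneg _)
    (hρ.sub hgi).norm (Eventually.of_forall fun x => ?_)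
  simp only [ContinuousMap.coe_mk, Real.norm_eq_abs]
  nth_rw 1 [← max_eq_left (h0 x)]
  exact abs_max_sub_max_le_abs _ _ _

/-! ### Selection of the subsequence -/

/-- A measure absolutely continuous with respect to the limit measure of a rotation along a
sequence is represented by a subsequence, selected by its indicator `ξ`. -/
theorem exists_selection (a : ℕ → ℕ) (ha : StrictMono a)
    (hlog : Tendsto (fun n : ℕ => Real.log (a n) / (n + 1)) atTop (𝓝 0))
    (hgood : ∀ β : UnitAddCircle, ∃ L : ℂ,
      Tendsto (seqAvg fun i => fourier 1 (a i • β)) atTop (𝓝 L))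
    (α : UnitAddCircle) (μ ν : Measure UnitAddCircle) [IsProbabilityMeasure μ]
    [IsProbabilityMeasure ν] (hνμ : ν ≪ μ)
    (hμ : ∀ φ : C(UnitAddCircle, ℂ),
      Tendsto (seqAvg fun i => φ (a i • α)) atTop (𝓝 (∫ x, φ x ∂μ))) :
    ∃ ξ : ℕ → ℝ, (∀ i, ξ i ∈ ({0, 1} : Set ℝ)) ∧
      Tendsto (fun n => ∑ i ∈ Finset.range n, ξ i) atTop atTop ∧
      (∀ β : UnitAddCircle, ∃ L : ℂ,
        Tendsto (fun n => (∑ i ∈ Finset.range n, (ξ i : ℂ) * fourier 1 (a i • β)) /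
          ((∑ i ∈ Finset.range n, ξ i : ℝ) : ℂ)) atTop (𝓝 L)) ∧
      ∀ m : ℤ, Tendsto (fun n =>
        (∑ i ∈ Finset.range n, (ξ i : ℂ) * fourier 1 (a i • (m • α))) /
          ((∑ i ∈ Finset.range n, ξ i : ℝ) : ℂ)) atTop (𝓝 (∫ x, (fourier m x : ℂ) ∂ν)) := by
  obtain ⟨N, hN⟩ := exists_rounding_fourier a ha hlog
  set ρ : UnitAddCircle → ℝ := fun x => (ν.rnDeriv μ x).toReal with hρ
  have hρi : Integrable ρ μ := Measure.integrable_toReal_rnDeriv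
  have hρ0 : ∀ x, 0 ≤ ρ x := fun x => ENNReal.toReal_nonneg
  -- The factor 1/8 makes consecutive L¹ distances strictly less than (1/2)^k, so the corresponding
  -- orbit averages eventually are too.
  choose g hg0 hgρ using fun k : ℕ => exists_continuous_nonneg_approx hρi hρ0
    (show (0 : ℝ) < (1 / 8) * (1 / 2) ^ k by positivity)
  have hgi : ∀ k, Integrable (g k) μ := fun k => (g k).integrable_circle μ
  have hgg : ∀ k, ∫ x, |g (k + 1) x - g k x| ∂μ < (1 / 2) ^ k := by
    intro k
    have h1 : ∫ x, |g (k + 1) x - g k x| ∂μ ≤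
        ∫ x, (|ρ x - g (k + 1) x| + |ρ x - g k x|) ∂μ := by
      refine integral_mono_of_nonneg (Eventually.of_forall fun x => abs_nonneg _)
        ((hρi.sub (hgi _)).abs.add (hρi.sub (hgi _)).abs) (Eventually.of_forall fun x => ?_)
      simp only
      rw [abs_sub_comm (ρ x) (g (k + 1) x)]
      exact abs_sub_le _ _ _
    have h5 := integral_add (hρi.sub (hgi (k + 1))).abs (hρi.sub (hgi k)).abs
    simp only [Pi.sub_apply] at h5
    rw [h5] at h1
    have h2 := hgρ k
    have h3 := hgρ (k + 1)
    have h4 : (0 : ℝ) < (1 / 2) ^ k := by positivity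
    rw [pow_succ] at h3
    linarith
  -- heights
  let C : ℕ → ℝ := fun k => 1 + ∑ l ∈ Finset.range (k + 1), ‖g l‖
  have hCm : Monotone C := monotone_nat_of_le_succ fun k => by
    simp only [C]
    rw [Finset.sum_range_succ _ (k + 1)]
    linarith [norm_nonneg (g (k + 1))]
  have hC1 : ∀ k, 1 ≤ C k := fun k => by
    simp only [C]
    linarith [Finset.sum_nonneg (s := Finset.range (k + 1)) fun l _ => norm_nonneg (g l)]
  have hC0 : ∀ k, 0 < C k := fun k => one_pos.trans_le (hC1 k)
  have hgC : ∀ k x, g k x ≤ C k := fun k x => by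
    have h1 := Finset.single_le_sum (f := fun l => ‖g l‖) (fun _ _ => norm_nonneg _)
      (Finset.mem_range.2 (Nat.lt_succ_self k))
    have h2 := (le_abs_self _).trans ((g k).norm_coe_le_norm x)
    simp only [C]
    linarith
  -- thresholds
  have hT : ∀ l : ℕ, ∃ T : ℕ, ∀ n ≥ T,
      (∑ i ∈ Finset.range n, |g l (a i • α) - g (l - 1) (a i • α)| ≤
        n * (1 / 2 : ℝ) ^ (l - 1)) ∧
      -- With `l = k n`, the weights sum to at least n/C l, so this tolerance makes the rounding
      -- error at most 1/(l+1) of their sum; the last condition makes the sum diverge.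
      N (1 / ((l + 1) * C l)) ≤ n ∧ l * C l ≤ n := by
    intro l
    have hA : ∀ᶠ n : ℕ in atTop, ∑ i ∈ Finset.range n, |g l (a i • α) - g (l - 1) (a i • α)| ≤
        n * (1 / 2 : ℝ) ^ (l - 1) := by
      rcases Nat.eq_zero_or_pos l with rfl | hl
      · exact Eventually.of_forall fun n => by simp
      obtain ⟨l, rfl⟩ : ∃ j, l = j + 1 := ⟨l - 1, by omega⟩
      simp only [Nat.add_sub_cancel]
      have h1 := (Complex.continuous_re.tendsto _).comp
        (hμ ⟨fun x => ((|g (l + 1) x - g l x| : ℝ) : ℂ), by fun_prop⟩)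
      simp only [ContinuousMap.coe_mk, integral_complex_ofReal, Complex.ofReal_re] at h1
      filter_upwards [h1.eventually (gt_mem_nhds (hgg l)), eventually_gt_atTop 0] with n hn hn0
      have hn0' : (0 : ℝ) < n := by exact_mod_cast hn0
      have h2 : (seqAvg (fun i => ((|g (l + 1) (a i • α) - g l (a i • α)| : ℝ) : ℂ)) n).re =
          (∑ i ∈ Finset.range n, |g (l + 1) (a i • α) - g l (a i • α)|) / n := by
        rw [seqAvg, ← Complex.ofReal_sum, one_div, div_eq_inv_mul, ← Complex.ofReal_natCast,
          ← Complex.ofReal_inv, ← Complex.ofReal_mul, Complex.ofReal_re]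
      simp only [Function.comp_apply] at hn
      rw [h2, div_lt_iff₀ hn0'] at hn
      linarith
    exact eventually_atTop.1 (hA.and ((eventually_ge_atTop _).and
      (tendsto_natCast_atTop_atTop.eventually_ge_atTop _)))
  choose T hT using hT
  obtain ⟨k, hkm, hkt, hkT⟩ := exists_slow_monotone T
  have hdiag := fun j => sum_abs_diagonal_sub_le (fun l i => g l (a i • α)) hkm hkt
    (fun n l hl => (hT (l + 1) n (hkT n (l + 1) (Nat.succ_pos l) hl)).1) j
  -- convergence of the unbounded averages
  have hconv : ∀ β : UnitAddCircle, ∃ L : ℂ, Tendsto (seqAvg fun i =>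
      (g (k i) (a i • α) : ℂ) * fourier 1 (a i • β)) atTop (𝓝 L) ∧
      ∀ l : ℕ → ℂ, (∀ j, Tendsto (seqAvg fun i => (g j (a i • α) : ℂ) * fourier 1 (a i • β))
        atTop (𝓝 (l j))) → Tendsto l atTop (𝓝 L) := by
    intro β
    choose L hL using fun j => exists_tendsto_seqAvg_mul_fourier hgood α β
      ⟨fun x => (g j x : ℂ), by fun_prop⟩
    simp only [ContinuousMap.coe_mk] at hL
    -- Of the factor 3, two units are the telescoping tail and one absorbs the constant `D`.
    have h3 : Tendsto (fun j : ℕ => 3 * (1 / 2 : ℝ) ^ j) atTop (𝓝 0) := by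
      simpa using (tendsto_pow_atTop_nhds_zero_of_lt_one (by norm_num : (0 : ℝ) ≤ 1 / 2)
        (by norm_num)).const_mul 3
    obtain ⟨l, hl, hLl⟩ := exists_tendsto_of_approx
      (u := seqAvg fun i => (g (k i) (a i • α) : ℂ) * fourier 1 (a i • β)) hL h3 (by
        intro j
        obtain ⟨D, hD⟩ := hdiag j
        filter_upwards [eventually_gt_atTop 0,
          tendsto_natCast_atTop_atTop.eventually_ge_atTop (D / (1 / 2 : ℝ) ^ j)] with n hn hn2
        rw [← seqAvg_sub]
        refine (norm_seqAvg_le _ _).trans ?_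
        rw [div_le_iff₀ (by exact_mod_cast hn)]
        rw [div_le_iff₀ (by positivity)] at hn2
        refine le_trans (le_trans (le_of_eq (Finset.sum_congr rfl fun i _ => ?_)) (hD n)) ?_
        · rw [← sub_mul, norm_mul, norm_fourier_one, mul_one, ← Complex.ofReal_sub,
            Complex.norm_real, Real.norm_eq_abs]
        · linarith)
    refine ⟨l, hl, fun l' hl' => ?_⟩
    have : l' = L := funext fun j => tendsto_nhds_unique (hl' j) (hL j)
    rwa [this]
  have hconvm : ∀ m : ℤ, Tendsto (seqAvg fun i =>
      (g (k i) (a i • α) : ℂ) * fourier 1 (a i • (m • α))) atTop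
      (𝓝 (∫ x, (fourier m x : ℂ) ∂ν)) := by
    intro m
    obtain ⟨L, hL, hL'⟩ := hconv (m • α)
    have h1 := hL' (fun j => ∫ x, (g j x : ℂ) * fourier m x ∂μ) (fun j => by
      refine (hμ ⟨fun x => (g j x : ℂ) * fourier m x, by fun_prop⟩).congr fun n => ?_
      congr 1
      funext i
      simp only [ContinuousMap.coe_mk, fourier_apply, one_smul]
      rw [smul_comm])
    -- L¹ convergence of `g j` to the density and absolute continuity turn the limit into an
    -- integral against ν.
    have h2 : Tendsto (fun j => ∫ x, (g j x : ℂ) * fourier m x ∂μ) atTop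
        (𝓝 (∫ x, (fourier m x : ℂ) ∂ν)) := by
      have := Measure.haveLebesgueDecomposition_of_sigmaFinite ν μ
      rw [← integral_rnDeriv_smul hνμ, tendsto_iff_norm_sub_tendsto_zero]
      have h3 : Tendsto (fun j : ℕ => (1 / 8) * (1 / 2 : ℝ) ^ j) atTop (𝓝 0) := by
        simpa using (tendsto_pow_atTop_nhds_zero_of_lt_one (by norm_num : (0 : ℝ) ≤ 1 / 2)
          (by norm_num)).const_mul (1 / 8 : ℝ)
      refine squeeze_zero (fun _ => norm_nonneg _) (fun j => ?_) h3
      have hn : ∀ x : UnitAddCircle, ‖(fourier m x : ℂ)‖ ≤ 1 := fun x => by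
        rw [fourier_apply]
        exact (Circle.norm_coe _).le
      have i1 : Integrable (fun x => (g j x : ℂ) * fourier m x) μ :=
        ContinuousMap.integrable_circle μ ⟨fun x => (g j x : ℂ) * fourier m x, by fun_prop⟩
      have i2 : Integrable (fun x => (ν.rnDeriv μ x).toReal • (fourier m x : ℂ)) μ :=
        hρi.smul_of_top_left
          (memLp_top_of_bound (fourier m).continuous.aestronglyMeasurable 1
            (Eventually.of_forall hn))
      rw [← integral_sub i1 i2]
      refine (norm_integral_le_integral_norm _).trans (le_trans ?_ (hgρ j))
      refine integral_mono_of_nonneg (Eventually.of_forall fun x => norm_nonneg _)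
        (hρi.sub (hgi _)).abs (Eventually.of_forall fun x => ?_)
      simp only [Complex.real_smul]
      rw [← sub_mul, norm_mul, ← Complex.ofReal_sub, Complex.norm_real, Real.norm_eq_abs,
        abs_sub_comm]
      exact mul_le_of_le_one_right (abs_nonneg _) (hn x)
    rwa [tendsto_nhds_unique h1 h2] at hL
  -- thinning
  let w : ℕ → ℝ := fun i => 1 / C (k i)
  have hw0 : ∀ i, 0 < w i := fun i => one_div_pos.2 (hC0 _)
  have hwa : Antitone w := fun i j h => one_div_le_one_div_of_le (hC0 _) (hCm (hkm h))
  let W : ℕ → ℝ := fun n => ∑ i ∈ Finset.range n, w i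
  have hWn : ∀ n, n / C (k n) ≤ W n := by
    intro n
    have := Finset.card_nsmul_le_sum (Finset.range n) w (w n)
      (fun i hi => hwa (Finset.mem_range.1 hi).le)
    rw [Finset.card_range, nsmul_eq_mul] at this
    simpa [W, w, div_eq_mul_inv] using this
  have hkev : ∀ᶠ n in atTop, 0 < k n := hkt.eventually_gt_atTop 0
  have hWt : Tendsto W atTop atTop := by
    refine tendsto_atTop_mono' atTop ?_ (tendsto_natCast_atTop_atTop.comp hkt)
    filter_upwards [hkev] with n hn
    refine le_trans ?_ (hWn n)
    rw [Function.comp_apply, le_div_iff₀ (hC0 _)]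
    exact (hT (k n) n (hkT n (k n) hn le_rfl)).2.2
  obtain ⟨ξ, hξ, hb⟩ := hN (fun i => w i * g (k i) (a i • α)) (fun i => by
    refine ⟨mul_nonneg (hw0 i).le (hg0 _ _), ?_⟩
    simp only [w]
    rw [one_div_mul_eq_div, div_le_one (hC0 _)]
    exact hgC _ _)
  have herr : ∀ β : UnitAddCircle, Tendsto (fun n =>
      (∑ i ∈ Finset.range n, ((ξ i - w i * g (k i) (a i • α) : ℝ) : ℂ) * fourier 1 (a i • β)) /
        (W n : ℂ)) atTop (𝓝 0) := by
    intro β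
    rw [tendsto_zero_iff_norm_tendsto_zero]
    refine squeeze_zero' (Eventually.of_forall fun _ => norm_nonneg _) ?_
      ((tendsto_one_div_add_atTop_nhds_zero_nat (𝕜 := ℝ)).comp hkt)
    filter_upwards [hkev, eventually_gt_atTop 0] with n hn hn0
    have hn0' : (0 : ℝ) < n := by exact_mod_cast hn0
    have h1 := hb (1 / ((k n + 1) * C (k n))) (by have := hC0 (k n); positivity) n
      (hT (k n) n (hkT n (k n) hn le_rfl)).2.1 β
    have hWpos : 0 < W n := (div_pos hn0' (hC0 _)).trans_le (hWn n)
    rw [norm_div, Complex.norm_real, Real.norm_eq_abs, abs_of_pos hWpos, div_le_iff₀ hWpos]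
    refine h1.trans ?_
    rw [Function.comp_apply]
    calc (1 : ℝ) / ((k n + 1) * C (k n)) * n = 1 / (k n + 1) * (n / C (k n)) := by
          have := (hC0 (k n)).ne'
          field_simp
      _ ≤ _ := by
          gcongr
          exact hWn n
  have hWξ : ∀ (β : UnitAddCircle) (L : ℂ), Tendsto (seqAvg fun i =>
      (g (k i) (a i • α) : ℂ) * fourier 1 (a i • β)) atTop (𝓝 L) →
      Tendsto (fun n => (∑ i ∈ Finset.range n, (ξ i : ℂ) * fourier 1 (a i • β)) / (W n : ℂ))
        atTop (𝓝 L) := by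
    intro β L hL
    have := (tendsto_weighted_average hwa hw0 hWt hL).add (herr β)
    rw [add_zero] at this
    refine this.congr fun n => ?_
    rw [← add_div, ← Finset.sum_add_distrib]
    congr 1
    refine Finset.sum_congr rfl fun i _ => ?_
    push_cast
    ring
  have hden : Tendsto (fun n => (∑ i ∈ Finset.range n, ξ i) / W n) atTop (𝓝 1) := by
    -- The case m = 0: since ν has mass 1, the number of selected terms is asymptotic to `W n`,
    -- which may thus replace it as normalization.
    have h1 := (Complex.continuous_re.tendsto _).comp (hWξ _ _ (hconvm 0))
    simp only [fourier_zero, integral_const, probReal_univ, one_smul, Complex.one_re] at h1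
    refine h1.congr fun n => ?_
    have : ∀ i, (fourier 1 (a i • ((0 : ℤ) • α)) : ℂ) = 1 := fun i => by
      simp [fourier_apply, AddCircle.toCircle_zero]
    simp only [Function.comp_apply, this, mul_one]
    rw [← Complex.ofReal_sum, ← Complex.ofReal_div, Complex.ofReal_re]
  have hratio : ∀ (β : UnitAddCircle) (L : ℂ), Tendsto (seqAvg fun i =>
      (g (k i) (a i • α) : ℂ) * fourier 1 (a i • β)) atTop (𝓝 L) →
      Tendsto (fun n => (∑ i ∈ Finset.range n, (ξ i : ℂ) * fourier 1 (a i • β)) /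
          ((∑ i ∈ Finset.range n, ξ i : ℝ) : ℂ)) atTop (𝓝 L) := by
    intro β L hL
    have h1 := (hWξ β L hL).div ((Complex.continuous_ofReal.tendsto _).comp hden) (by simp)
    rw [Complex.ofReal_one, div_one] at h1
    refine h1.congr' ?_
    filter_upwards [hWt.eventually_gt_atTop 0] with n hn
    have : (W n : ℂ) ≠ 0 := by exact_mod_cast hn.ne'
    simp only [Pi.div_apply, Function.comp_apply, Complex.ofReal_div]
    rw [div_div_div_cancel_right₀ this]
  refine ⟨ξ, hξ, ?_, fun β => ?_, fun m => hratio _ _ (hconvm m)⟩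
  · refine (hden.pos_mul_atTop one_pos hWt).congr' ?_
    filter_upwards [hWt.eventually_gt_atTop 0] with n hn
    exact div_mul_cancel₀ _ hn.ne'
  · obtain ⟨L, hL, -⟩ := hconv β
    exact ⟨L, hratio β L hL⟩

/-! ### From sequences back to sets of integers -/

theorem sum_initialSegment_eq {a : ℕ → ℕ} (ha : Function.Injective a) (hpos : ∀ i, 0 < a i)
    {ξ : ℕ → ℝ} (hξ : ∀ i, ξ i ∈ ({0, 1} : Set ℝ)) {N n : ℕ} (hn : ∀ i, i < n ↔ a i ≤ N)
    (f : ℕ → ℂ) :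
    ∑ s ∈ initialSegment {s | ∃ i, ξ i = 1 ∧ a i = s} N, f s =
      ∑ i ∈ Finset.range n, (ξ i : ℂ) * f (a i) := by
  classical
  have h : initialSegment {s | ∃ i, ξ i = 1 ∧ a i = s} N =
      ((Finset.range n).filter fun i => ξ i = 1).image a := by
    ext s
    simp only [initialSegment, Finset.mem_filter, Finset.mem_Icc, Set.mem_ofPred_eq,
      Finset.mem_image, Finset.mem_range]
    constructor
    · rintro ⟨⟨-, h⟩, i, hi, rfl⟩
      exact ⟨i, ⟨(hn i).2 h, hi⟩, rfl⟩
    · rintro ⟨i, ⟨h, hi⟩, rfl⟩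
      exact ⟨⟨hpos i, (hn i).1 h⟩, i, hi, rfl⟩
  rw [h, Finset.sum_image (fun i _ j _ hij => ha hij), Finset.sum_filter]
  refine Finset.sum_congr rfl fun i _ => ?_
  have h : ξ i = 0 ∨ ξ i = 1 := hξ i
  rcases h with h | h <;> simp [h]

theorem card_initialSegment_eq {a : ℕ → ℕ} (ha : Function.Injective a) (hpos : ∀ i, 0 < a i)
    {ξ : ℕ → ℝ} (hξ : ∀ i, ξ i ∈ ({0, 1} : Set ℝ)) {N n : ℕ} (hn : ∀ i, i < n ↔ a i ≤ N) :
    ((initialSegment {s | ∃ i, ξ i = 1 ∧ a i = s} N).card : ℝ) =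
      ∑ i ∈ Finset.range n, ξ i := by
  have := sum_initialSegment_eq ha hpos hξ hn fun _ => 1
  simp only [Finset.sum_const, nsmul_eq_mul, mul_one] at this
  exact_mod_cast this

theorem avgAlong_eq_div {a : ℕ → ℕ} (ha : Function.Injective a) (hpos : ∀ i, 0 < a i)
    {ξ : ℕ → ℝ} (hξ : ∀ i, ξ i ∈ ({0, 1} : Set ℝ)) {N n : ℕ} (hn : ∀ i, i < n ↔ a i ≤ N)
    (f : ℕ → ℂ) :
    avgAlong {s | ∃ i, ξ i = 1 ∧ a i = s} N f =
      (∑ i ∈ Finset.range n, (ξ i : ℂ) * f (a i)) /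
        ((∑ i ∈ Finset.range n, ξ i : ℝ) : ℂ) := by
  rw [avgAlong, sum_initialSegment_eq ha hpos hξ hn, ← card_initialSegment_eq ha hpos hξ hn,
    one_div_mul_eq_div, Complex.ofReal_natCast]

/-- The increasing enumeration of an infinite set of natural numbers, with its counting function. -/
theorem exists_strictMono_enumeration {R : Set ℕ} (hR : R.Infinite) :
    ∃ a c : ℕ → ℕ, StrictMono a ∧ (∀ s, s ∈ R ↔ ∃ i, a i = s) ∧ ∀ N i, i < c N ↔ a i ≤ N := by
  classical
  have hinf : (Set.ofPred (· ∈ R)).Infinite := hR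
  refine ⟨Nat.nth (· ∈ R), fun N => Nat.count (· ∈ R) (N + 1), Nat.nth_strictMono hinf,
    fun s => ⟨fun hs => ⟨Nat.count (· ∈ R) s, Nat.nth_count hs⟩, ?_⟩, fun N i => ?_⟩
  · rintro ⟨i, rfl⟩
    exact Nat.nth_mem_of_infinite hinf i
  · rw [Nat.lt_nth_iff_count_lt hinf, Nat.lt_succ_iff]

theorem mainTheorem3 (R : Set ℕ) (hR : IsGoodSet R) (hsub : IsSublacunary R)
    (α : ℝ) (hα : Irrational α)
    (ν : Measure UnitAddCircle) [IsProbabilityMeasure ν]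
    (hν : ν ≪ limitMeasure R (α : UnitAddCircle)) :
    ∃ S : Set ℕ, S ⊆ R ∧ IsGoodSet S ∧ limitMeasure S (α : UnitAddCircle) = ν := by
  obtain ⟨μ, hμ⟩ := hR.exists_isLimitMeasure (α : UnitAddCircle)
  rw [hμ.eq_limitMeasure] at hν
  have := hμ.prob
  obtain ⟨a, c, ha, haR', hc⟩ := exists_strictMono_enumeration hR.infinite
  have haR : ∀ i, a i ∈ R := fun i => (haR' _).2 ⟨i, rfl⟩
  have hpos : ∀ i, 0 < a i := fun i => hR.pos _ (haR i)
  -- `R` is itself the selection with constant indicator 1, so the same counting formulas serve `R`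
  -- and `S`.
  have hRa : {s | ∃ i, (1 : ℝ) = 1 ∧ a i = s} = R := by
    ext s
    simp [haR']
  have hone : ∀ i : ℕ, (fun _ : ℕ => (1 : ℝ)) i ∈ ({0, 1} : Set ℝ) := fun i => by simp
  have hlt : ∀ n i, i < n + 1 ↔ a i ≤ a n := fun n i => by
    rw [ha.le_iff_le, Nat.lt_succ_iff]
  have hat : Tendsto a atTop atTop := ha.tendsto_atTop
  have havg : ∀ (f : ℕ → ℂ) (L : ℂ), Tendsto (fun N => avgAlong R N f) atTop (𝓝 L) →
      Tendsto (seqAvg fun i => f (a i)) atTop (𝓝 L) := by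
    intro f L h
    rw [← tendsto_add_atTop_iff_nat 1]
    refine (h.comp hat).congr fun n => ?_
    have h1 := avgAlong_eq_div ha.injective hpos hone (hlt n) f
    rw [hRa] at h1
    rw [Function.comp_apply, h1, seqAvg]
    simp [div_eq_inv_mul]
  -- Indices start at 0, so `R` has n + 1 elements up to `a n`.
  have hlog : Tendsto (fun n : ℕ => Real.log (a n) / (n + 1)) atTop (𝓝 0) := by
    refine (hsub.comp hat).congr fun n => ?_
    have h1 := card_initialSegment_eq ha.injective hpos hone (hlt n)
    rw [hRa] at h1
    rw [Function.comp_apply, h1]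
    simp
  have hct : Tendsto c atTop atTop := tendsto_atTop.2 fun b => by
    filter_upwards [eventually_ge_atTop (a b)] with N hN
    exact ((hc N b).2 hN).le
  have hgoodR : ∀ β : UnitAddCircle, ∃ L : ℂ,
      Tendsto (seqAvg fun i => fourier 1 (a i • β)) atTop (𝓝 L) := fun β => by
    obtain ⟨L, hL⟩ := hR.converges β
    exact ⟨L, havg (fun s => fourier 1 (s • β)) L hL⟩
  have hμR : ∀ φ : C(UnitAddCircle, ℂ),
      Tendsto (seqAvg fun i => φ (a i • (α : UnitAddCircle))) atTop (𝓝 (∫ x, φ x ∂μ)) := fun φ =>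
    havg (fun s => φ (s • (α : UnitAddCircle))) _ (hμ.tendsto φ)
  obtain ⟨ξ, hξ, hsum, hgood, hlim⟩ :=
    exists_selection a ha hlog hgoodR (α : UnitAddCircle) μ ν hν hμR
  have havgS := fun N => avgAlong_eq_div ha.injective hpos hξ (hc N)
  have hS : IsGoodSet {s | ∃ i, ξ i = 1 ∧ a i = s} := by
    refine ⟨?_, fun hfin => ?_, fun β => ?_⟩
    · rintro _ ⟨i, -, rfl⟩
      exact hpos i
    · obtain ⟨N, hN⟩ := ((hsum.comp hct).eventually_gt_atTop (hfin.toFinset.card : ℝ)).exists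
      rw [Function.comp_apply, ← card_initialSegment_eq ha.injective hpos hξ (hc N)] at hN
      refine absurd (Finset.card_le_card fun s hs => ?_) (not_le.2 (by exact_mod_cast hN))
      rw [Set.Finite.mem_toFinset]
      simp only [initialSegment, Finset.mem_filter] at hs
      exact hs.2
    · obtain ⟨L, hL⟩ := hgood β
      exact ⟨L, (hL.comp hct).congr fun N => (havgS N _).symm⟩
  refine ⟨_, ?_, hS, ?_⟩
  · rintro _ ⟨i, -, rfl⟩
    exact haR i
  have hκ := hS.isLimitMeasure_limitMeasure (α : UnitAddCircle)
  have := hκ.prob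
  -- The limit measure of the good set `S` already exists, so only its Fourier coefficients have to
  -- be compared with those of ν.
  refine measure_eq_of_integral_fourier_eq fun m => ?_
  refine tendsto_nhds_unique (hκ.tendsto (fourier m)) (((hlim m).comp hct).congr fun N => ?_)
  rw [Function.comp_apply, havgS N]
  congr 1
  refine Finset.sum_congr rfl fun i _ => ?_
  simp only [fourier_apply, one_smul]
  rw [smul_comm]
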